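/- Let $G$ be a (Hausdorff, second countable, finite-dimensional, real) Lie group with Lie algebra $\mathfrak g$, let $P$ be a closed subgroup of $G$, let $X=G/P$, and assume that $P$ acts faithfully on $X$. A Cartan geometry $(M,\hat M,\omega)$ modelled on $X$ consists of a smooth principal $P$-bundle $\hat M\to M$ over a manifold $M$ (equivalently, a smooth manifold $\hat M$ with a smooth, free and proper right action of $P$, and $M=\hat M/P$) and a smooth $\mathfrak g$-valued $1$-form $\omega$ on $\hat M$ such that: (1) $\omega_{\hat x}:T_{\hat x}\hat M\to\mathfrak g$ is an isomorphism for every $\hat x\in\hat M$; (2) for every one-parameter subgroup $t\mapsto \exp(tY)$ of $P$, one has $\omega\big(\tfrac{d}{dt}\big|_{t=0}\hat x\cdot\exp(tY)\big)=Y$ for all $\hat x\in\hat M$; (3) $R_p^*\omega=\mathrm{Ad}(p^{-1})\,\omega$ for all $p\in P$. A geometric embedding of $(M,\hat M,\omega)$ into $(N,\hat N,\omega')$ is a $P$-equivariant smooth embedding $\sigma:\hat M\to\hat N$ with $\sigma^*\omega'=\omega$. A Cartan geometry $(M,\hat M,\omega)$ modelled on $X$ is called maximal if every geometric embedding of it into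 a Cartan geometry $(N,\hat N,\omega')$ modelled on $X$, with $N$ connected, is onto. Let $\Gamma$ be a discrete subgroup of $G$ acting freely and properly on $X$. The Kleinian manifold $M=\Gamma\backslash X$ carries a canonical Cartan geometry modelled on $X$: its bundle is $\Gamma\backslash G\to\Gamma\backslash X$, with $P$ acting by right translations, and its form is induced by the left-invariant Maurer–Cartan form of $G$. Then the Kleinian manifold $M=\Gamma\backslash X$, with its canonical Cartan geometry, is maximal. -/

import Mathlib

open Set Filter Topology MulAction
open scoped Manifold ContDiff

universe uN uB

noncomputable section

/-! ### Lie group preliminaries -/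

/-- The Maurer-Cartan form of a Lie group `G`: at `g`, it is the derivative
`T_g G → T_1 G = 𝔤` of left translation by `g⁻¹`. -/
def maurerCartan (E : Type*) [NormedAddCommGroup E] [NormedSpace ℝ E]
    {G : Type*} [TopologicalSpace G] [ChartedSpace E G] [Group G] (g : G) :
    TangentSpace 𝓘(ℝ, E) g →L[ℝ] GroupLieAlgebra 𝓘(ℝ, E) G :=
  show E →L[ℝ] E from mfderiv 𝓘(ℝ, E) 𝓘(ℝ, E) (fun h : G => g⁻¹ * h) g

/-- The adjoint action `Ad g : 𝔤 → 𝔤`, the derivative at `1` of `h ↦ g h g⁻¹`. -/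
def lieAd (E : Type*) [NormedAddCommGroup E] [NormedSpace ℝ E]
    {G : Type*} [TopologicalSpace G] [ChartedSpace E G] [Group G] (g : G) :
    GroupLieAlgebra 𝓘(ℝ, E) G →L[ℝ] GroupLieAlgebra 𝓘(ℝ, E) G :=
  show E →L[ℝ] E from mfderiv 𝓘(ℝ, E) 𝓘(ℝ, E) (fun h : G => g * h * g⁻¹) 1

/-! ### Cartan geometries -/

/-- A Cartan geometry `(M, B, ω)` modelled on `G / P`, where `G` is a Lie group (with Lie algebra
`𝔤 = T_1 G`, of which `E` is the underlying vector space) and `P` is a closed subgroup of `G`.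

The principal `P`-bundle `B → M` is given by a smooth manifold `B` with a smooth, free and proper
right action of `P`, and a quotient map `B → M` whose fibres are the `P`-orbits. (The smooth
structure of the base `M` is the unique one for which the projection is a submersion; it is
determined by `B` and the action. Since
`ω` identifies all tangent spaces of `B` with `𝔤`, the manifold `B` is modelled on `E`.) -/
structure CartanGeometry (E : Type*) [NormedAddCommGroup E] [NormedSpace ℝ E]
    {G : Type*} [TopologicalSpace G] [ChartedSpace E G] [Group G] (P : Subgroup G)
    (M : Type*) [TopologicalSpace M]
    (B : Type*) [TopologicalSpace B] [ChartedSpace E B] where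
  isManifold : IsManifold 𝓘(ℝ, E) ∞ B
  t2Space : T2Space B
  secondCountable : SecondCountableTopology B
  /-- The bundle projection. -/
  proj : B → M
  /-- The right action of `P`. -/
  act : B → P → B
  act_one : ∀ x, act x 1 = x
  act_mul : ∀ x p q, act x (p * q) = act (act x p) q
  isQuotientMap_proj : IsQuotientMap proj
  proj_eq_iff : ∀ x y, proj x = proj y ↔ ∃ p, act x p = y
  act_free : ∀ x p, act x p = x → p = 1
  act_proper : IsProperMap fun q : B × P => (q.1, act q.1 q.2)
  /-- The action map `B × P → B` is smooth, for the smooth structure of `P` as an embedded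
  submanifold of `G`: it is locally the restriction of smooth maps defined on open subsets
  of `B × G`. -/
  act_smooth : ∀ (x₀ : B) (p₀ : P), ∃ (U : Set (B × G)) (f : B × G → B),
    IsOpen U ∧ (x₀, (p₀ : G)) ∈ U ∧
    ContMDiffOn (𝓘(ℝ, E).prod 𝓘(ℝ, E)) 𝓘(ℝ, E) ∞ f U ∧
    ∀ (x : B) (p : P), (x, (p : G)) ∈ U → f (x, (p : G)) = act x p
  /-- The Cartan connection, a `𝔤`-valued `1`-form on `B`. -/
  form : ∀ x : B, TangentSpace 𝓘(ℝ, E) x →L[ℝ] GroupLieAlgebra 𝓘(ℝ, E) G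
  /-- A `1`-form is smooth when it is smooth as a function on the tangent bundle. -/
  form_smooth : ContMDiff (M' := E) 𝓘(ℝ, E).tangent 𝓘(ℝ, E) ∞
    fun v : TangentBundle 𝓘(ℝ, E) B => form v.1 v.2
  form_bijective : ∀ x, Function.Bijective (form x)
  /-- If `t ↦ c t = Exp (t X)` is a one-parameter subgroup of `P`, with `X = c'(0)`, then the value
  of the form on the vector field `x ↦ d/dt (x · c t)` at `t = 0` is `X`. -/
  form_fundamental : ∀ c : ℝ → P, (∀ s t, c (s + t) = c s * c t) →
    ContMDiff 𝓘(ℝ, ℝ) 𝓘(ℝ, E) ∞ (fun t => (c t : G)) →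
    ∀ x : B, (form (act x (c 0))
        (mfderiv 𝓘(ℝ, ℝ) 𝓘(ℝ, E) (fun t => act x (c t)) 0 (1 : ℝ)) : E) =
      mfderiv 𝓘(ℝ, ℝ) 𝓘(ℝ, E) (fun t => (c t : G)) 0 (1 : ℝ)
  /-- `R_p^* ω = Ad (p⁻¹) ω`. -/
  form_equivariant : ∀ (p : P) (x : B) (v : TangentSpace 𝓘(ℝ, E) x),
    form (act x p) (mfderiv 𝓘(ℝ, E) 𝓘(ℝ, E) (fun y => act y p) x v) =
      lieAd E ((p : G)⁻¹) (form x v)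

namespace CartanGeometry

variable {E : Type*} [NormedAddCommGroup E] [NormedSpace ℝ E]
  {G : Type*} [TopologicalSpace G] [ChartedSpace E G] [Group G] {P : Subgroup G}

/-- A geometric embedding of Cartan geometries: a smooth embedding `σ` of the total spaces which is
a morphism of principal `P`-bundles and satisfies `σ^* ω' = ω`. -/
structure IsGeometricEmbedding
    {M : Type*} [TopologicalSpace M] {B : Type*} [TopologicalSpace B] [ChartedSpace E B]
    {M' : Type*} [TopologicalSpace M'] {B' : Type*} [TopologicalSpace B'] [ChartedSpace E B']
    (C : CartanGeometry E P M B) (C' : CartanGeometry E P M' B') (σ : B → B') : Prop where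
  isSmoothEmbedding : Manifold.IsSmoothEmbedding 𝓘(ℝ, E) 𝓘(ℝ, E) ∞ σ
  equivariant : ∀ x p, σ (C.act x p) = C'.act (σ x) p
  pullback : ∀ (x : B) (v : TangentSpace 𝓘(ℝ, E) x),
    C'.form (σ x) (mfderiv 𝓘(ℝ, E) 𝓘(ℝ, E) σ x v) = C.form x v

/-- A Cartan geometry is (geometrically) maximal if every geometric embedding of it into a Cartan
geometry over a connected manifold `N`, with the same model, is onto. -/
def IsMaximal {M : Type*} [TopologicalSpace M]
    {B : Type*} [TopologicalSpace B] [ChartedSpace E B] (C : CartanGeometry E P M B) : Prop :=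
  ∀ (N : Type uN) [TopologicalSpace N] [ConnectedSpace N]
    (B' : Type uB) [TopologicalSpace B'] [ChartedSpace E B'] (C' : CartanGeometry E P N B')
    (σ : B → B'), IsGeometricEmbedding C C' σ → Function.Surjective σ

end CartanGeometry

/-! ### The bundle `Γ \ G` -/

/-- The space `Γ \ G` of right cosets of `Γ`, the quotient of `G` by left translations. -/
def KleinBundle {G : Type*} [Group G] (Γ : Subgroup G) : Type _ := orbitRel.Quotient Γ G

namespace KleinBundle

/-- The projection `G → Γ \ G`. -/
def mk {G : Type*} [Group G] (Γ : Subgroup G) (g : G) : KleinBundle Γ :=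
  Quotient.mk (orbitRel Γ G) g

/-- The right translation by `p` on `Γ \ G`, `(Γ g) · p = Γ (g p)`. -/
def rmul {G : Type*} [Group G] {Γ : Subgroup G} (x : KleinBundle Γ) (p : G) : KleinBundle Γ :=
  Quotient.map' (· * p) (by
    rintro a b ⟨γ, rfl⟩
    exact ⟨γ, by simp [Subgroup.smul_def, mul_assoc]⟩) x

instance {G : Type*} [Group G] [TopologicalSpace G] (Γ : Subgroup G) :
    TopologicalSpace (KleinBundle Γ) :=
  inferInstanceAs (TopologicalSpace (orbitRel.Quotient Γ G))

section Topology

variable {G : Type*} [Group G] (Γ : Subgroup G)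

lemma mk_surjective : Function.Surjective (mk Γ) := Quotient.mk_surjective

variable {Γ} in
lemma mk_eq_mk {g h : G} : mk Γ g = mk Γ h ↔ ∃ γ ∈ Γ, γ * h = g := by
  refine Quotient.eq''.trans ⟨?_, ?_⟩
  · rintro ⟨γ, h⟩; exact ⟨γ, γ.2, h⟩
  · rintro ⟨γ, hγ, h⟩; exact ⟨⟨γ, hγ⟩, h⟩

@[simp] lemma rmul_mk (g p : G) : rmul (mk Γ g) p = mk Γ (g * p) := rfl

variable [TopologicalSpace G]

lemma isQuotientMap_mk : IsQuotientMap (mk Γ) := isQuotientMap_quotient_mk'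

lemma isQuotientCoveringMap_mk [IsTopologicalGroup G] [DiscreteTopology Γ] :
    IsQuotientCoveringMap (mk Γ) Γ :=
  (isQuotientMap_mk Γ).isQuotientCoveringMap_of_subgroup Γ
    (isDiscrete_iff_discreteTopology.mpr ‹_›) fun {a b} => by
      rw [mk_eq_mk]
      constructor
      · rintro ⟨γ, hγ, rfl⟩; simpa using Γ.inv_mem hγ
      · intro h; exact ⟨(b * a⁻¹)⁻¹, Γ.inv_mem h, by simp⟩

lemma isLocalHomeomorph_mk [IsTopologicalGroup G] [DiscreteTopology Γ] :
    IsLocalHomeomorph (mk Γ) :=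
  (isQuotientCoveringMap_mk Γ).isCoveringMap.isLocalHomeomorph

lemma continuous_rmul [IsTopologicalGroup G] [DiscreteTopology Γ] :
    Continuous fun q : KleinBundle Γ × G => rmul q.1 q.2 := by
  have h : IsOpenQuotientMap (Prod.map (mk Γ) (id : G → G)) :=
    (isQuotientCoveringMap_mk Γ).isOpenQuotientMap.prodMap .id
  rw [h.isQuotientMap.continuous_iff]
  exact (isQuotientMap_mk Γ).continuous.comp continuous_mul

variable {Γ} in
/-- If `Γ` acts properly on `G / P`, then `P` acts properly on `Γ \ G`. -/
lemma isProperMap_rmul [IsTopologicalGroup G] [DiscreteTopology Γ] [T2Space (KleinBundle Γ)]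
    {P : Subgroup G} (hP : IsClosed (P : Set G)) [ProperSMul Γ (G ⧸ P)] :
    IsProperMap fun q : KleinBundle Γ × P => (q.1, rmul q.1 (q.2 : G)) := by
  rw [isProperMap_iff_ultrafilter_of_t2]
  refine ⟨continuous_fst.prodMk ((continuous_rmul Γ).comp
    (continuous_fst.prodMk (continuous_subtype_val.comp continuous_snd))), ?_⟩
  rintro 𝒰 ⟨b, a⟩ hlim
  obtain ⟨g, rfl⟩ := mk_surjective Γ b
  obtain ⟨h, rfl⟩ := mk_surjective Γ a
  have hb : Tendsto (fun q : KleinBundle Γ × P => q.1) 𝒰 (𝓝 (mk Γ g)) :=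
    (continuous_fst.tendsto _).comp hlim
  have ha : Tendsto (fun q : KleinBundle Γ × P => rmul q.1 (q.2 : G)) 𝒰 (𝓝 (mk Γ h)) :=
    (continuous_snd.tendsto _).comp hlim
  have sec : ∀ g : G, ∃ e : KleinBundle Γ → G, ContinuousAt e (mk Γ g) ∧ e (mk Γ g) = g ∧
      ∀ᶠ y in 𝓝 (mk Γ g), mk Γ (e y) = y := by
    intro g
    let e := (isLocalHomeomorph_mk Γ).localInverseAt g
    have he : ∀ g, e.symm g = mk Γ g := fun g => by simp [e]
    have hy : mk Γ g ∈ e.source :=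
      (isLocalHomeomorph_mk Γ).apply_self_mem_localInverseAt_source
    refine ⟨e, e.continuousAt hy, by simp [e], ?_⟩
    filter_upwards [e.open_source.mem_nhds hy] with y hy
    rw [← he, e.left_inv hy]
  obtain ⟨e, he1, he2, he3⟩ := sec g
  obtain ⟨e', he1', he2', he3'⟩ := sec h
  have hs : Tendsto (fun q : KleinBundle Γ × P => e q.1) 𝒰 (𝓝 g) := by
    have := he1.tendsto.comp hb; rwa [he2] at this
  have ht : Tendsto (fun q : KleinBundle Γ × P => e' (rmul q.1 q.2)) 𝒰 (𝓝 h) := by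
    have := he1'.tendsto.comp ha; rwa [he2'] at this
  have hγ : ∀ᶠ q : KleinBundle Γ × P in 𝒰, ∃ γ : Γ, (γ : G) * (e q.1 * q.2) = e' (rmul q.1 q.2) := by
    filter_upwards [hb.eventually he3, ha.eventually he3'] with q h1 h2
    have h3 : mk Γ (e' (rmul q.1 q.2)) = mk Γ (e q.1 * q.2) := by
      rw [h2, ← rmul_mk, h1]
    obtain ⟨γ, hγ, h4⟩ := mk_eq_mk.mp h3
    exact ⟨⟨γ, hγ⟩, h4⟩
  choose! γ hγ using fun (q : KleinBundle Γ × P)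
    (hq : ∃ γ : Γ, (γ : G) * (e q.1 * q.2) = e' (rmul q.1 q.2)) => hq
  rename ∀ᶠ q in _, _ => hev
  have hpr := (isProperMap_iff_ultrafilter.mp
    (ProperSMul.isProperMap_smul_pair (G := Γ) (X := G ⧸ P))).2
  have hcont : Continuous (QuotientGroup.mk : G → G ⧸ P) := QuotientGroup.continuous_mk
  obtain ⟨⟨γ₀, x₀⟩, -, hle⟩ := hpr
    (𝒰 := 𝒰.map fun q => (γ q, (QuotientGroup.mk (e q.1) : G ⧸ P)))
    (y := (QuotientGroup.mk h, QuotientGroup.mk g)) (by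
      rw [Ultrafilter.coe_map, tendsto_map'_iff]
      refine Tendsto.prodMk_nhds ?_ ((hcont.tendsto g).comp hs)
      refine ((hcont.tendsto h).comp ht).congr' ?_
      filter_upwards [hev] with q hq
      simp only [Function.comp_apply]
      rw [← hγ q hq, ← mul_assoc, QuotientGroup.mk_mul_of_mem _ q.2.2]
      rfl)
  have hγlim : Tendsto (fun q => (γ q : G)) 𝒰 (𝓝 (γ₀ : G)) := by
    have h1 : Tendsto (fun q => (γ q, (QuotientGroup.mk (e q.1) : G ⧸ P))) 𝒰 (𝓝 (γ₀, x₀)) := hle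
    exact ((continuous_subtype_val.comp continuous_fst).tendsto (γ₀, x₀)).comp h1
  have hplim : Tendsto (fun q : KleinBundle Γ × P => (q.2 : G)) 𝒰
      (𝓝 (((γ₀ : G) * g)⁻¹ * h)) := by
    refine ((hγlim.mul hs).inv.mul ht).congr' ?_
    filter_upwards [hev] with q hq
    rw [← hγ q hq]
    group
  have hmem : ((γ₀ : G) * g)⁻¹ * h ∈ P :=
    hP.mem_of_tendsto hplim (Eventually.of_forall fun q => q.2.2)
  refine ⟨(mk Γ g, ⟨_, hmem⟩), ?_⟩
  have : Tendsto (fun q : KleinBundle Γ × P => (q.1, q.2)) 𝒰 (𝓝 (mk Γ g, ⟨_, hmem⟩)) :=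
    hb.prodMk_nhds (tendsto_subtype_rng.mpr hplim)
  exact this

lemma secondCountableTopology [IsTopologicalGroup G] [DiscreteTopology Γ]
    [SecondCountableTopology G] : SecondCountableTopology (KleinBundle Γ) :=
  (isQuotientMap_mk Γ).secondCountableTopology
    (isQuotientCoveringMap_mk Γ).isOpenQuotientMap.isOpenMap

end Topology

/-! #### The smooth structure of `Γ \ G` -/

section Manifold

variable {E : Type*} [NormedAddCommGroup E] [NormedSpace ℝ E]
  {G : Type*} [TopologicalSpace G] [ChartedSpace E G] [Group G] [LieGroup 𝓘(ℝ, E) ∞ G]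
  (Γ : Subgroup G)

lemma contMDiffOn_localInverse_comp_mk (e : OpenPartialHomeomorph (KleinBundle Γ) G)
    (he : ∀ g, e.symm g = mk Γ g) :
    ContMDiffOn 𝓘(ℝ, E) 𝓘(ℝ, E) ∞ (fun g => e (mk Γ g)) (mk Γ ⁻¹' e.source) := by
  have : IsTopologicalGroup G := topologicalGroup_of_lieGroup 𝓘(ℝ, E) ∞
  intro g hg
  obtain ⟨γ, hγ, h⟩ : ∃ γ ∈ Γ, γ * g = e (mk Γ g) := by
    rw [← mk_eq_mk, ← he, e.left_inv hg]
  have h1 : ContMDiffAt 𝓘(ℝ, E) 𝓘(ℝ, E) ∞ (fun z : G => γ * z) g := contMDiffAt_mul_left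
  refine (h1.congr_of_eventuallyEq ?_).contMDiffWithinAt
  have h2 : ∀ᶠ z in 𝓝 g, γ * z ∈ e.target := by
    apply (continuous_const_mul γ).continuousAt.eventually
    exact e.open_target.mem_nhds (by simpa only [h] using e.map_source hg)
  filter_upwards [h2] with z hz
  have h3 : mk Γ z = mk Γ (γ * z) := (mk_eq_mk.mpr ⟨γ, hγ, rfl⟩).symm
  rw [h3, ← he, e.right_inv hz]

variable [DiscreteTopology Γ]

/-- The charts of `Γ \ G` are the charts of `G` composed with local inverses of `G → Γ \ G`. -/
instance instChartedSpace : ChartedSpace E (KleinBundle Γ) :=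
  haveI : IsTopologicalGroup G := topologicalGroup_of_lieGroup 𝓘(ℝ, E) ∞
  (isLocalHomeomorph_mk Γ).chartedSpace (mk_surjective Γ)

instance instIsManifold : IsManifold 𝓘(ℝ, E) ∞ (KleinBundle Γ) := by
  have : IsTopologicalGroup G := topologicalGroup_of_lieGroup 𝓘(ℝ, E) ∞
  apply isManifold_of_contDiffOn
  rintro e e' ⟨q, rfl⟩ ⟨q', rfl⟩
  set s := (isLocalHomeomorph_mk Γ).localInverseAt ((mk_surjective Γ).hasRightInverse.choose q)
    with hs
  set s' := (isLocalHomeomorph_mk Γ).localInverseAt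
    ((mk_surjective Γ).hasRightInverse.choose q') with hs'
  set c := chartAt E ((mk_surjective Γ).hasRightInverse.choose q)
  set c' := chartAt E ((mk_surjective Γ).hasRightInverse.choose q')
  rw [← contMDiffOn_iff_contDiffOn]
  intro x hx
  have hx' : ((x ∈ c.target ∧ c.symm x ∈ s.target) ∧ mk Γ (c.symm x) ∈ s'.source) ∧
      s' (mk Γ (c.symm x)) ∈ c'.source := by
    simpa [hs, and_assoc] using hx
  obtain ⟨⟨⟨h1, h2⟩, h3⟩, h4⟩ := hx'
  have k1 : ContMDiffAt 𝓘(ℝ, E) 𝓘(ℝ, E) ∞ c.symm x :=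
    (contMDiffOn_chart_symm x h1).contMDiffAt (c.open_target.mem_nhds h1)
  have k2 : ContMDiffAt 𝓘(ℝ, E) 𝓘(ℝ, E) ∞ (fun g => s' (mk Γ g)) (c.symm x) :=
    (contMDiffOn_localInverse_comp_mk Γ s' (by simp [hs']) _ h3).contMDiffAt
      ((s'.open_source.preimage (isQuotientMap_mk Γ).continuous).mem_nhds h3)
  have k3 : ContMDiffAt 𝓘(ℝ, E) 𝓘(ℝ, E) ∞ c' (s' (mk Γ (c.symm x))) :=
    (contMDiffOn_chart _ h4).contMDiffAt (c'.open_source.mem_nhds h4)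
  have k := k3.comp x (k2.comp x k1)
  refine ContMDiffAt.contMDiffWithinAt ?_
  convert k using 1
  ext z
  simp [hs]

lemma exists_chartAt_eq (y : KleinBundle Γ) :
    ∃ (g : G) (s : OpenPartialHomeomorph (KleinBundle Γ) G), (∀ g, s.symm g = mk Γ g) ∧ chartAt E y = s.trans (chartAt E g) :=
  ⟨_, _, fun g => by simp, rfl⟩

lemma contMDiff_mk : ContMDiff 𝓘(ℝ, E) 𝓘(ℝ, E) ∞ (mk Γ) := by
  intro g
  obtain ⟨g₀, s, hs, h⟩ := exists_chartAt_eq (E := E) Γ (mk Γ g)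
  have h0 : mk Γ g ∈ (chartAt E (mk Γ g)).source := mem_chart_source E _
  have h1 : mk Γ g ∈ s.source ∧ s (mk Γ g) ∈ (chartAt E g₀).source := by
    rw [h] at h0; simpa using h0
  have k1 : ContMDiffAt 𝓘(ℝ, E) 𝓘(ℝ, E) ∞ (fun g => s (mk Γ g)) g :=
    (contMDiffOn_localInverse_comp_mk Γ s hs _ h1.1).contMDiffAt
      ((s.open_source.preimage (isQuotientMap_mk Γ).continuous).mem_nhds h1.1)
  have k2 : ContMDiffAt 𝓘(ℝ, E) 𝓘(ℝ, E) ∞ (chartAt E g₀) (s (mk Γ g)) :=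
    (contMDiffOn_chart _ h1.2).contMDiffAt ((chartAt E g₀).open_source.mem_nhds h1.2)
  have k3 : ContMDiffAt 𝓘(ℝ, E) 𝓘(ℝ, E) ∞ (chartAt E (mk Γ g)).symm
      (chartAt E g₀ (s (mk Γ g))) := by
    have h2 : chartAt E g₀ (s (mk Γ g)) ∈ (chartAt E (mk Γ g)).target := by
      have := (chartAt E (mk Γ g)).map_source h0
      rw [h] at this ⊢
      exact this
    exact (contMDiffOn_chart_symm _ h2).contMDiffAt
      ((chartAt E (mk Γ g)).open_target.mem_nhds h2)
  refine (k3.comp g (k2.comp g k1)).congr_of_eventuallyEq ?_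
  filter_upwards [(isQuotientMap_mk Γ).continuous.continuousAt.preimage_mem_nhds
    ((chartAt E (mk Γ g)).open_source.mem_nhds h0)] with z hz
  have h3 := (chartAt E (mk Γ g)).left_inv hz
  conv at h3 => enter [1, 2]; rw [h]
  exact h3.symm

lemma contMDiffOn_localInverse (e : OpenPartialHomeomorph (KleinBundle Γ) G)
    (he : ∀ g, e.symm g = mk Γ g) :
    ContMDiffOn 𝓘(ℝ, E) 𝓘(ℝ, E) ∞ e e.source := by
  intro y hy
  obtain ⟨g₀, s, hs, h⟩ := exists_chartAt_eq (E := E) Γ y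
  have h0 : y ∈ (chartAt E y).source := mem_chart_source E _
  have h1 : y ∈ s.source ∧ s y ∈ (chartAt E g₀).source := by
    rw [h] at h0; simpa using h0
  have k1 : ContMDiffAt 𝓘(ℝ, E) 𝓘(ℝ, E) ∞ (chartAt E y) y :=
    (contMDiffOn_chart _ h0).contMDiffAt ((chartAt E y).open_source.mem_nhds h0)
  have h2 : chartAt E y y = chartAt E g₀ (s y) := by rw [h]; rfl
  have k2 : ContMDiffAt 𝓘(ℝ, E) 𝓘(ℝ, E) ∞ (chartAt E g₀).symm (chartAt E y y) := by
    have h3 : chartAt E y y ∈ (chartAt E g₀).target := by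
      rw [h2]; exact (chartAt E g₀).map_source h1.2
    exact (contMDiffOn_chart_symm _ h3).contMDiffAt ((chartAt E g₀).open_target.mem_nhds h3)
  have h4 : mk Γ (s y) = y := by rw [← hs, s.left_inv h1.1]
  have h5 : (chartAt E g₀).symm (chartAt E y y) = s y := by
    rw [h2, (chartAt E g₀).left_inv h1.2]
  have k3 : ContMDiffAt 𝓘(ℝ, E) 𝓘(ℝ, E) ∞ (fun g => e (mk Γ g))
      ((chartAt E g₀).symm (chartAt E y y)) := by
    have h6 : mk Γ (s y) ∈ e.source := by rw [h4]; exact hy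
    rw [h5]
    exact (contMDiffOn_localInverse_comp_mk Γ e he _ h6).contMDiffAt
      ((e.open_source.preimage (isQuotientMap_mk Γ).continuous).mem_nhds h6)
  refine ((k3.comp y (k2.comp y k1)).congr_of_eventuallyEq ?_).contMDiffWithinAt
  filter_upwards [(chartAt E y).open_source.mem_nhds h0] with z hz
  have hz' : z ∈ s.source ∧ s z ∈ (chartAt E g₀).source := by
    rw [h] at hz; simpa using hz
  have h7 : chartAt E y z = chartAt E g₀ (s z) := by rw [h]; rfl
  simp only [Function.comp_def, h7]
  rw [(chartAt E g₀).left_inv hz'.2, ← hs, s.left_inv hz'.1]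

lemma isLocalDiffeomorph_mk : IsLocalDiffeomorph 𝓘(ℝ, E) 𝓘(ℝ, E) ∞ (mk Γ) := by
  have : IsTopologicalGroup G := topologicalGroup_of_lieGroup 𝓘(ℝ, E) ∞
  intro g
  let e := (isLocalHomeomorph_mk Γ).localInverseAt g
  have he : ∀ g, e.symm g = mk Γ g := fun g => by simp [e]
  refine ⟨⟨e.symm.toPartialEquiv, e.open_target, e.open_source, ?_, ?_⟩, ?_, ?_⟩
  · exact (contMDiff_mk Γ).contMDiffOn.congr fun z _ => he z
  · exact contMDiffOn_localInverse Γ e he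
  · exact (isLocalHomeomorph_mk Γ).self_mem_localInverseAt_target
  · exact fun z _ => (he z).symm

lemma t2Space [FiniteDimensional ℝ E] [T2Space G] : T2Space (KleinBundle Γ) := by
  have : IsTopologicalGroup G := topologicalGroup_of_lieGroup 𝓘(ℝ, E) ∞
  have : LocallyCompactSpace E := @locallyCompact_of_proper E _ (FiniteDimensional.proper ℝ E)
  have : LocallyCompactSpace G := ChartedSpace.locallyCompactSpace E G
  have : ProperlyDiscontinuousSMul Γ G := Γ.properlyDiscontinuousSMul_of_tendsto_cofinite
    (Γ.tendsto_coe_cofinite_of_discrete (isDiscrete_iff_discreteTopology.mpr ‹_›))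
  exact t2Space_of_properlyDiscontinuousSMul_of_t2Space

/-! #### The Cartan connection of `Γ \ G` -/

/-- The `𝔤`-valued form on `Γ \ G` induced by the Maurer-Cartan form of `G`; it is computed at any
representative of a coset, see `form_mk`. -/
def form (y : KleinBundle Γ) :
    TangentSpace 𝓘(ℝ, E) y →L[ℝ] GroupLieAlgebra 𝓘(ℝ, E) G :=
  show E →L[ℝ] E from
    (maurerCartan E ((mk_surjective Γ).hasRightInverse.choose y)).comp
      (mfderiv 𝓘(ℝ, E) 𝓘(ℝ, E) (mk Γ) ((mk_surjective Γ).hasRightInverse.choose y)).inverse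

lemma mdiff_left (g h : G) :
    MDifferentiableAt 𝓘(ℝ, E) 𝓘(ℝ, E) (fun z : G => g * z) h :=
  (contMDiff_mul_left (n := ∞)).mdifferentiableAt (by simp)

lemma mdiff_right (g h : G) :
    MDifferentiableAt 𝓘(ℝ, E) 𝓘(ℝ, E) (fun z : G => z * g) h :=
  (contMDiff_mul_right (n := ∞)).mdifferentiableAt (by simp)

lemma mdiff_mk (g : G) : MDifferentiableAt 𝓘(ℝ, E) 𝓘(ℝ, E) (mk Γ) g :=
  (contMDiff_mk Γ).mdifferentiableAt (by simp)

/-- Left invariance of the Maurer-Cartan form. -/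
lemma maurerCartan_mul_left (γ g : G) (v : TangentSpace 𝓘(ℝ, E) g) :
    maurerCartan E (γ * g) (mfderiv 𝓘(ℝ, E) 𝓘(ℝ, E) (fun h : G => γ * h) g v) =
      maurerCartan E g v := by
  have h := mfderiv_comp_apply g (mdiff_left (E := E) (γ * g)⁻¹ (γ * g))
    (mdiff_left (E := E) γ g) v
  have h2 : (fun z : G => (γ * g)⁻¹ * z) ∘ (fun z : G => γ * z) = fun z => g⁻¹ * z := by
    ext z; simp [mul_assoc]
  rw [h2] at h
  exact h.symm

/-- The pullback of the form under `G → Γ \ G` is the Maurer-Cartan form of `G`. -/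
lemma form_mk (g : G) (v : TangentSpace 𝓘(ℝ, E) g) :
    form Γ (mk Γ g) (mfderiv 𝓘(ℝ, E) 𝓘(ℝ, E) (mk Γ) g v) = maurerCartan E g v := by
  obtain ⟨g', hg', hdef⟩ : ∃ g', mk Γ g' = mk Γ g ∧ ∀ w : E, (form (E := E) Γ (mk Γ g) w : E) =
      maurerCartan E g' ((mfderiv 𝓘(ℝ, E) 𝓘(ℝ, E) (mk Γ) g').inverse w) :=
    ⟨_, (mk_surjective Γ).hasRightInverse.choose_spec _, fun w => rfl⟩
  obtain ⟨γ, hγ, rfl⟩ := mk_eq_mk.mp hg'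
  refine (hdef _).trans ?_
  have h := mfderiv_comp_apply g (mdiff_mk (E := E) Γ (γ * g)) (mdiff_left (E := E) γ g) v
  have h2 : mk Γ ∘ (fun z : G => γ * z) = mk Γ := by
    ext z; exact mk_eq_mk.mpr ⟨γ, hγ, rfl⟩
  rw [h2] at h
  rw [← maurerCartan_mul_left γ g v]
  have h3 := (isLocalDiffeomorph_mk (E := E) Γ).mfderivToContinuousLinearEquiv_coe
    (by simp) (γ * g)
  refine congrArg (maurerCartan E (γ * g)) ?_
  have h4 : ((mfderiv 𝓘(ℝ, E) 𝓘(ℝ, E) (mk Γ) g v : TangentSpace 𝓘(ℝ, E) (mk Γ g)) : E) = _ := h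
  refine (congrArg _ h4).trans ?_
  rw [← h3, ContinuousLinearMap.inverse_equiv]
  exact ContinuousLinearEquiv.symm_apply_apply _ _


/-- The Maurer-Cartan form is smooth. -/
lemma contMDiff_maurerCartan :
    ContMDiff (M' := E) 𝓘(ℝ, E).tangent 𝓘(ℝ, E) ∞
      fun v : TangentBundle 𝓘(ℝ, E) G => maurerCartan E v.1 v.2 := by
  let I := 𝓘(ℝ, E)
  let F : TangentBundle I G → TangentBundle I G × TangentBundle I G := fun v =>
    (⟨v.1⁻¹, (0 : E)⟩, v)
  have hF : ContMDiff I.tangent (I.tangent.prod I.tangent) ∞ F := by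
    refine ContMDiff.prodMk ?_ contMDiff_id
    have h1 : ContMDiff I I.tangent ∞
        (fun g : G => (⟨g, (0 : E)⟩ : TangentBundle I G)) :=
      Bundle.contMDiff_zeroSection ℝ (TangentSpace I : G → Type _)
    have h2 : ContMDiff I.tangent I ∞ (fun v : TangentBundle I G => v.1⁻¹) :=
      (contMDiff_inv I ∞).comp (Bundle.contMDiff_proj (TangentSpace I))
    exact h1.comp h2
  let S : TangentBundle I G → TangentBundle I G :=
    (tangentMap (I.prod I) I (fun p : G × G => p.1 * p.2)) ∘
      (equivTangentBundleProd I G I G).symm ∘ F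
  have hS : ContMDiff I.tangent I.tangent ∞ S :=
    (ContMDiff.contMDiff_tangentMap (n := ∞) (contMDiff_mul I ∞) (by simp)).comp
      (contMDiff_equivTangentBundleProd_symm.comp hF)
  have hS' : ∀ v, S v = ⟨v.1⁻¹ * v.1, maurerCartan E v.1 v.2⟩ := by
    intro v
    have h := mfderiv_prod_eq_add_apply (I := I) (I' := I) (I'' := I)
      (f := fun p : G × G => p.1 * p.2) (p := (v.1⁻¹, v.1)) (v := ((0 : E), (v.2 : E)))
      ((contMDiff_mul I ∞).mdifferentiableAt (by simp))
    refine congrArg (Bundle.TotalSpace.mk (v.1⁻¹ * v.1)) (h.trans ?_)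
    refine (congrArg₂ (· + ·) (ContinuousLinearMap.map_zero _) rfl).trans ?_
    exact zero_add (maurerCartan E v.1 v.2)
  intro v
  have h := (Bundle.contMDiffAt_totalSpace.mp (hS v)).2
  refine h.congr_of_eventuallyEq (Eventually.of_forall fun w => ?_)
  have key : ∀ (p q : G) (_ : q = p) (a : E),
      (trivializationAt E (TangentSpace I : G → Type _) p ⟨q, a⟩).2 = a := by
    rintro p _ rfl a
    exact (tangentBundleCore I G).coordChange_self _ _ (mem_chart_source E _) a
  dsimp only
  rw [hS' w, hS' v]
  exact (key _ _ (by simp) _).symm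

lemma form_smooth : ContMDiff (M' := E) 𝓘(ℝ, E).tangent 𝓘(ℝ, E) ∞
    fun v : TangentBundle 𝓘(ℝ, E) (KleinBundle Γ) => form Γ v.1 v.2 := by
  have : IsTopologicalGroup G := topologicalGroup_of_lieGroup 𝓘(ℝ, E) ∞
  rintro ⟨y, w⟩
  obtain ⟨g, rfl⟩ := mk_surjective Γ y
  let e := (isLocalHomeomorph_mk Γ).localInverseAt g
  have he : ∀ g, e.symm g = mk Γ g := fun g => by simp [e]
  have hy : mk Γ g ∈ e.source := (isLocalHomeomorph_mk Γ).apply_self_mem_localInverseAt_source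
  have h1 := (contMDiffOn_localInverse (E := E) Γ e he).contMDiffOn_tangentMapWithin (m := ∞)
    (by simp) e.open_source.uniqueMDiffOn
  have hU : IsOpen (Bundle.TotalSpace.proj (F := E)
      (E := (TangentSpace 𝓘(ℝ, E) : KleinBundle Γ → Type _)) ⁻¹' e.source) :=
    e.open_source.preimage (FiberBundle.continuous_proj E _)
  have h2 := (h1 ⟨mk Γ g, w⟩ hy).contMDiffAt (hU.mem_nhds hy)
  refine ((contMDiff_maurerCartan (E := E) (G := G)).contMDiffAt.comp _ h2).congr_of_eventuallyEq ?_
  filter_upwards [hU.mem_nhds hy] with v hv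
  obtain ⟨y, w⟩ := v
  have hv' : y ∈ e.source := hv
  obtain ⟨h, hh, rfl, hmem⟩ : ∃ h, e y = h ∧ mk Γ h = y ∧ h ∈ e.target :=
    ⟨_, rfl, by rw [← he, e.left_inv hv'], e.map_source hv'⟩
  obtain ⟨u, rfl⟩ := ((isLocalDiffeomorph_mk (E := E) Γ).mfderivToContinuousLinearEquiv
    (by simp) h).surjective w
  refine (form_mk Γ h u).trans ?_
  have hd : MDifferentiableAt 𝓘(ℝ, E) 𝓘(ℝ, E) e (mk Γ h) :=
    ((contMDiffOn_localInverse (E := E) Γ e he).contMDiffAt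
      (e.open_source.mem_nhds hv')).mdifferentiableAt (by simp)
  have hc := mfderiv_comp_apply h hd (mdiff_mk (E := E) Γ h) u
  have hid : e ∘ mk Γ =ᶠ[𝓝 h] id := by
    filter_upwards [e.open_target.mem_nhds hmem] with z hz
    simp only [Function.comp_apply, id]
    rw [← he, e.right_inv hz]
  rw [hid.mfderiv_eq, mfderiv_id] at hc
  have hw : mfderivWithin 𝓘(ℝ, E) 𝓘(ℝ, E) e e.source (mk Γ h) =
      mfderiv 𝓘(ℝ, E) 𝓘(ℝ, E) e (mk Γ h) :=
    mfderivWithin_of_mem_nhds (e.open_source.mem_nhds hv')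
  have hmc : ∀ (a : G) (_ : a = h) (b : E), (maurerCartan E a b : E) = maurerCartan E h b := by
    rintro _ rfl b; rfl
  refine (Eq.trans ?_ (hmc (e (mk Γ h)) hh _).symm)
  refine congrArg (maurerCartan E h) ?_
  refine Eq.trans hc ?_
  exact (congrArg (fun L : E →L[ℝ] E =>
    L (mfderiv 𝓘(ℝ, E) 𝓘(ℝ, E) (mk Γ) h u)) hw).symm

lemma form_bijective (y : KleinBundle Γ) : Function.Bijective (form (E := E) Γ y) := by
  obtain ⟨g, rfl⟩ := mk_surjective Γ y
  have h1 := ((isLocalDiffeomorph_mk (E := E) Γ).mfderivToContinuousLinearEquiv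
    (by simp) g).bijective
  have h2 : Function.Bijective (maurerCartan E g) := by
    have := (Diffeomorph.smul 𝓘(ℝ, E) 𝓘(ℝ, E) ∞ g⁻¹ : G ≃ₘ^∞⟮𝓘(ℝ, E), 𝓘(ℝ, E)⟯ G).mfderivToContinuousLinearEquiv
      (by simp) g |>.bijective
    exact this
  refine (Function.Bijective.of_comp_iff _ h1).mp ?_
  convert h2 using 1
  ext v
  exact form_mk Γ g v

/-! #### The right action on `Γ \ G` -/

lemma contMDiff_rmul : ContMDiff (𝓘(ℝ, E).prod 𝓘(ℝ, E)) 𝓘(ℝ, E) ∞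
    fun q : KleinBundle Γ × G => rmul q.1 q.2 := by
  have : IsTopologicalGroup G := topologicalGroup_of_lieGroup 𝓘(ℝ, E) ∞
  rintro ⟨y, p⟩
  obtain ⟨g, rfl⟩ := mk_surjective Γ y
  let e := (isLocalHomeomorph_mk Γ).localInverseAt g
  have he : ∀ g, e.symm g = mk Γ g := fun g => by simp [e]
  have hy : mk Γ g ∈ e.source := (isLocalHomeomorph_mk Γ).apply_self_mem_localInverseAt_source
  have h1 : ContMDiffAt 𝓘(ℝ, E) 𝓘(ℝ, E) ∞ e (mk Γ g) :=
    (contMDiffOn_localInverse (E := E) Γ e he).contMDiffAt (e.open_source.mem_nhds hy)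
  have h2 : ContMDiffAt (𝓘(ℝ, E).prod 𝓘(ℝ, E)) 𝓘(ℝ, E) ∞
      (fun q : KleinBundle Γ × G => e q.1 * q.2) (mk Γ g, p) :=
    (h1.comp (mk Γ g, p) contMDiffAt_fst).mul contMDiffAt_snd
  refine ((contMDiff_mk Γ).contMDiffAt.comp _ h2).congr_of_eventuallyEq ?_
  filter_upwards [(e.open_source.preimage continuous_fst).mem_nhds
    (show (mk Γ g, p) ∈ Prod.fst ⁻¹' e.source from hy)] with q hq
  simp only [Function.comp_apply]
  rw [← rmul_mk, ← he, e.left_inv hq]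

lemma form_rmul (p : G) (x : KleinBundle Γ) (v : TangentSpace 𝓘(ℝ, E) x) :
    form Γ (rmul x p) (mfderiv 𝓘(ℝ, E) 𝓘(ℝ, E) (fun y => rmul y p) x v) =
      lieAd E p⁻¹ (form Γ x v) := by
  obtain ⟨g, rfl⟩ := mk_surjective Γ x
  obtain ⟨u, rfl⟩ := ((isLocalDiffeomorph_mk (E := E) Γ).mfderivToContinuousLinearEquiv
    (by simp) g).surjective v
  have hR : MDifferentiableAt 𝓘(ℝ, E) 𝓘(ℝ, E) (fun y : KleinBundle Γ => rmul y p) (mk Γ g) :=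
    ((contMDiff_rmul (E := E) Γ).comp
      (contMDiff_id.prodMk contMDiff_const)).mdifferentiableAt (by simp)
  have e1 := mfderiv_comp_apply g hR (mdiff_mk (E := E) Γ g) u
  have e2 := mfderiv_comp_apply g (mdiff_mk (E := E) Γ (g * p)) (mdiff_right (E := E) p g) u
  have e3 := mfderiv_comp_apply g (mdiff_left (E := E) (g * p)⁻¹ (g * p))
    (mdiff_right (E := E) p g) u
  have hA : MDifferentiableAt 𝓘(ℝ, E) 𝓘(ℝ, E) (fun h : G => p⁻¹ * h * (p⁻¹)⁻¹) (g⁻¹ * g) :=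
    ((contMDiff_mul_right (n := ∞)).comp
      (contMDiff_mul_left (n := ∞))).mdifferentiableAt (by simp)
  have e4 := mfderiv_comp_apply g hA (mdiff_left (E := E) g⁻¹ g) u
  have f1 : (fun h : G => p⁻¹ * h * (p⁻¹)⁻¹) ∘ (fun h : G => g⁻¹ * h) =
      (fun z => (g * p)⁻¹ * z) ∘ (fun h : G => h * p) := by
    ext z; simp [mul_assoc]
  have f2 : (fun y : KleinBundle Γ => rmul y p) ∘ mk Γ = mk Γ ∘ (fun h : G => h * p) := rfl
  rw [f2] at e1
  rw [f1] at e4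
  have hAd : ∀ (a : G) (_ : a = 1) (b : E),
      (mfderiv 𝓘(ℝ, E) 𝓘(ℝ, E) (fun h : G => p⁻¹ * h * (p⁻¹)⁻¹) a b : E) = lieAd E p⁻¹ b := by
    rintro _ rfl b; rfl
  have r := hAd (g⁻¹ * g) (by simp) (maurerCartan E g u)
  have l := form_mk (E := E) Γ (g * p)
    (mfderiv 𝓘(ℝ, E) 𝓘(ℝ, E) (fun h : G => h * p) g u)
  refine (congrArg (fun w : E => (form (E := E) Γ (mk Γ (g * p)) w : E))
    (e1.symm.trans e2)).trans (l.trans (e3.symm.trans (e4.trans (r.trans ?_))))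
  exact congrArg (lieAd E p⁻¹) (form_mk Γ g u).symm

lemma form_fundamental (c : ℝ → G) (hc : c 0 = 1) (hsmooth : ContMDiff 𝓘(ℝ, ℝ) 𝓘(ℝ, E) ∞ c)
    (x : KleinBundle Γ) :
    (form Γ (rmul x (c 0))
      (mfderiv 𝓘(ℝ, ℝ) 𝓘(ℝ, E) (fun t => rmul x (c t)) 0 (1 : ℝ)) : E) =
      mfderiv 𝓘(ℝ, ℝ) 𝓘(ℝ, E) c 0 (1 : ℝ) := by
  obtain ⟨g, rfl⟩ := mk_surjective Γ x
  have hd : MDifferentiableAt 𝓘(ℝ, ℝ) 𝓘(ℝ, E) c 0 := hsmooth.mdifferentiableAt (by simp)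
  have hd' : MDifferentiableAt 𝓘(ℝ, ℝ) 𝓘(ℝ, E) (fun t => g * c t) 0 :=
    (mdiff_left (E := E) g (c 0)).comp 0 hd
  have e1 := mfderiv_comp_apply (0 : ℝ) (mdiff_mk (E := E) Γ (g * c 0)) hd' (1 : ℝ)
  have e2 := mfderiv_comp_apply (0 : ℝ) (mdiff_left (E := E) (g * c 0)⁻¹ (g * c 0)) hd' (1 : ℝ)
  have f : (fun z => (g * c 0)⁻¹ * z) ∘ (fun t => g * c t) = c := by
    ext t; simp [hc]
  rw [f] at e2
  have l := form_mk (E := E) Γ (g * c 0)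
    (mfderiv 𝓘(ℝ, ℝ) 𝓘(ℝ, E) (fun t => g * c t) 0 (1 : ℝ))
  exact (congrArg (fun w : E => (form (E := E) Γ (mk Γ (g * c 0)) w : E)) e1).trans
    (l.trans e2.symm)

end Manifold

end KleinBundle

/-! ### Kleinian manifolds -/

/-- The bundle projection `Γ \ G → Γ \ (G / P)`, `Γ g ↦ Γ (g P)`. -/
def kleinianProj {G : Type*} [Group G] (Γ P : Subgroup G) :
    KleinBundle Γ → orbitRel.Quotient Γ (G ⧸ P) :=
  Quotient.map' (QuotientGroup.mk : G → G ⧸ P) (by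
    rintro a b ⟨γ, rfl⟩
    exact ⟨γ, rfl⟩)

/-- The canonical Cartan geometry of the Kleinian manifold `Γ \ X`, where `X = G / P` and `Γ` is a
discrete subgroup of `G` acting freely and properly on `X`: the total space is `Γ \ G`, with the
right action of `P` by right translations and the form induced by the Maurer-Cartan form of `G`. -/
def kleinianGeometry (E : Type*) [NormedAddCommGroup E] [NormedSpace ℝ E] [FiniteDimensional ℝ E]
    {G : Type*} [TopologicalSpace G] [ChartedSpace E G] [Group G] [LieGroup 𝓘(ℝ, E) ∞ G]
    [T2Space G] [SecondCountableTopology G] (P : Subgroup G) (hP : IsClosed (P : Set G))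
    (Γ : Subgroup G) [DiscreteTopology Γ]
    (hfree : ∀ (γ : Γ) (x : G ⧸ P), γ • x = x → γ = 1) [ProperSMul Γ (G ⧸ P)] :
    CartanGeometry E P (orbitRel.Quotient Γ (G ⧸ P)) (KleinBundle Γ) where
  isManifold := KleinBundle.instIsManifold Γ
  t2Space := KleinBundle.t2Space (E := E) Γ
  secondCountable :=
    have : IsTopologicalGroup G := topologicalGroup_of_lieGroup 𝓘(ℝ, E) ∞
    KleinBundle.secondCountableTopology Γ
  proj := kleinianProj Γ P
  act x p := KleinBundle.rmul x p
  act_one := by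
    rintro ⟨g⟩
    exact congrArg (KleinBundle.mk Γ) (mul_one g)
  act_mul := by
    rintro ⟨g⟩ p q
    exact congrArg (KleinBundle.mk Γ) (mul_assoc g p q).symm
  isQuotientMap_proj := by
    have h1 : IsQuotientMap (kleinianProj Γ P ∘ KleinBundle.mk Γ) :=
      (isQuotientMap_quotient_mk' (s := orbitRel Γ (G ⧸ P))).comp (QuotientGroup.isQuotientMap_mk P)
    refine IsQuotientMap.of_comp (KleinBundle.isQuotientMap_mk Γ).continuous ?_ h1
    exact (KleinBundle.isQuotientMap_mk Γ).continuous_iff.mpr h1.continuous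
  proj_eq_iff x y := by
    obtain ⟨g, rfl⟩ := KleinBundle.mk_surjective Γ x
    obtain ⟨h, rfl⟩ := KleinBundle.mk_surjective Γ y
    refine (Quotient.eq'' (s₁ := orbitRel Γ (G ⧸ P))).trans ?_
    constructor
    · rintro ⟨γ, hγ⟩
      have hγ' : (((γ : G) * h : G) : G ⧸ P) = (g : G ⧸ P) := hγ
      rw [eq_comm, QuotientGroup.eq] at hγ'
      refine ⟨⟨_, hγ'⟩, ?_⟩
      rw [KleinBundle.rmul_mk, KleinBundle.mk_eq_mk]
      exact ⟨γ, γ.2, by simp⟩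
    · rintro ⟨p, hp⟩
      rw [KleinBundle.rmul_mk, KleinBundle.mk_eq_mk] at hp
      obtain ⟨γ, hγ, hp⟩ := hp
      refine ⟨⟨γ, hγ⟩, ?_⟩
      change ((γ * h : G) : G ⧸ P) = (g : G ⧸ P)
      rw [hp, QuotientGroup.mk_mul_of_mem _ p.2]
  act_free x p hp := by
    obtain ⟨g, rfl⟩ := KleinBundle.mk_surjective Γ x
    rw [KleinBundle.rmul_mk, KleinBundle.mk_eq_mk] at hp
    obtain ⟨γ, hγ, h⟩ := hp
    have h1 : (⟨γ, hγ⟩ : Γ) = 1 := by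
      refine hfree _ (g : G ⧸ P) ?_
      change ((γ * g : G) : G ⧸ P) = (g : G ⧸ P)
      rw [h, QuotientGroup.mk_mul_of_mem _ p.2]
    have h2 : γ = 1 := congrArg Subtype.val h1
    rw [h2, one_mul] at h
    exact Subtype.ext (by simpa using h.symm)
  act_proper := by
    have : IsTopologicalGroup G := topologicalGroup_of_lieGroup 𝓘(ℝ, E) ∞
    have : T2Space (KleinBundle Γ) := KleinBundle.t2Space (E := E) Γ
    exact KleinBundle.isProperMap_rmul hP
  act_smooth _ _ := ⟨univ, fun q => KleinBundle.rmul q.1 q.2, isOpen_univ, mem_univ _,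
    (KleinBundle.contMDiff_rmul Γ).contMDiffOn, fun _ _ _ => rfl⟩
  form := KleinBundle.form Γ
  form_smooth := KleinBundle.form_smooth Γ
  form_bijective := KleinBundle.form_bijective Γ
  form_fundamental c hc hsmooth x := by
    have h0 : c 0 = 1 := by simpa using hc 0 0
    exact KleinBundle.form_fundamental Γ (fun t => (c t : G)) (by simp [h0]) hsmooth x
  form_equivariant p x v := KleinBundle.form_rmul Γ (p : G) x v
end

/-! A Cartan connection is a parallelism of the total space, and the parallelism of `G` is complete:
left-invariant fields have integral curves for all time. Completeness prevents any proper extension.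
Given a geometric embedding `σ` into `(N, B', ω')`, compose it with `G → Γ \ G` to get `f : G → B'`,
which is `P`-equivariant and pulls `ω'` back to the Maurer-Cartan form. Every point `y` near `x` in
`B'` is joined to `x` by an integral curve of an `ω'`-constant field
(`eventually_exists_isMIntegralCurveOn`). If this curve meets the range of `f`, it is the image of a
complete integral curve in `G`, by uniqueness, so it never leaves the range. The range is therefore
clopen (`isClopen_range_of_pullback_eq_maurerCartan`). Since `B'` may be disconnected when `P` is,
one descends to `N`: the range is `P`-invariant, its image in `N` is clopen and nonempty, hence
everything. -/

/-! ### Local surjectivity of the time-one map for `z' = A(z) Y`. -/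

/-- A variant of the Picard-Lindelöf theorem which also says that the solution stays in the ball. -/
theorem IsPicardLindelof.exists_forall_mem_Icc_hasDerivWithinAt_mem_closedBall
    {E : Type*} [NormedAddCommGroup E] [NormedSpace ℝ E] [CompleteSpace E]
    {f : ℝ → E → E} {tmin tmax : ℝ} {t₀ : Icc tmin tmax} {x₀ x : E} {a r L K : NNReal}
    (hf : IsPicardLindelof f t₀ x₀ a r L K) (hx : x ∈ Metric.closedBall x₀ r) :
    ∃ α : ℝ → E, α t₀ = x ∧ (∀ t, α t ∈ Metric.closedBall x₀ a) ∧
      ∀ t ∈ Icc tmin tmax, HasDerivWithinAt α (f t (α t)) (Icc tmin tmax) t := by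
  -- Curves in the Picard function space are `L`-Lipschitz and start within `r` of `x₀`, which
  -- confines them to radius `a`. `compProj` clamps time to the interval, so the bound holds for
  -- every real `t`.
  obtain ⟨α, hα⟩ := ODE.FunSpace.exists_isFixedPt_next hf hx
  refine ⟨α.compProj, by rw [ODE.FunSpace.compProj_val, ← hα, ODE.FunSpace.next_apply₀],
    fun t ↦ α.compProj_mem_closedBall hf.mul_max_le, fun t ht ↦ ?_⟩
  apply ODE.hasDerivWithinAt_picard_Icc t₀.2 hf.continuousOn_uncurry
    α.continuous_compProj.continuousOn (fun _ ht' ↦ α.compProj_mem_closedBall hf.mul_max_le)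
    x ht |>.congr_of_mem _ ht
  intro t' ht'
  nth_rw 1 [← hα]
  rw [ODE.FunSpace.compProj_of_mem ht', ODE.FunSpace.next_apply]

/-- If two solutions of `z' = A(z) Y` for different values of the parameter `Y` start at the
same point, their difference at time one is close to `A₀ (Y - Z)`. -/
theorem norm_sub_sub_le_of_hasDerivAt_clm
    {E : Type*} [NormedAddCommGroup E] [NormedSpace ℝ E]
    {A : E → E →L[ℝ] E} {A₀ : E →L[ℝ] E} {s : Set E} {K : NNReal} {η ρ : ℝ}
    (hK : LipschitzOnWith K A s) (hη : ∀ x ∈ s, ‖A x - A₀‖ ≤ η) (hρ : K * ρ ≤ 1 / 2)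
    {Y Z : E} (hY : ‖Y‖ ≤ ρ) {y z : ℝ → E} (hyz : y 0 = z 0)
    (hys : ∀ t, y t ∈ s) (hzs : ∀ t, z t ∈ s)
    (hy : ∀ t ∈ Icc (0 : ℝ) 1, HasDerivAt y (A (y t) Y) t)
    (hz : ∀ t ∈ Icc (0 : ℝ) 1, HasDerivAt z (A (z t) Z) t) :
    ‖y 1 - z 1 - A₀ (Y - Z)‖ ≤ (2 * (K * ρ) * (‖A₀‖ + η) + η) * ‖Y - Z‖ := by
  have hcont : ContinuousOn (fun t => ‖y t - z t‖) (Icc 0 1) := fun t ht =>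
    ((hy t ht).continuousAt.sub (hz t ht).continuousAt).norm.continuousWithinAt
  -- The maximal distance `S` between the two solutions is bounded in terms of itself and then
  -- absorbed, which replaces a Grönwall estimate.
  obtain ⟨t₁, ht₁, hmax⟩ := isCompact_Icc.exists_isMaxOn (nonempty_Icc.mpr zero_le_one) hcont
  set S := ‖y t₁ - z t₁‖ with hS
  have hS0 : 0 ≤ S := norm_nonneg _
  have hη0 : 0 ≤ η := (norm_nonneg _).trans (hη _ (hys 0))
  have hρ0 : 0 ≤ ρ := (norm_nonneg _).trans hY
  have hbound : ∀ t ∈ Icc (0 : ℝ) 1, ‖A (y t) Y - A (z t) Z - A₀ (Y - Z)‖ ≤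
      K * ρ * S + η * ‖Y - Z‖ := by
    intro t ht
    -- The first term is small because `Y` is small, the second because `A` is close to `A₀`.
    have h1 : A (y t) Y - A (z t) Z - A₀ (Y - Z) =
        (A (y t) - A (z t)) Y + (A (z t) - A₀) (Y - Z) := by
      simp only [sub_apply, map_sub]; abel
    rw [h1]
    refine (norm_add_le _ _).trans (add_le_add ?_ ?_)
    · refine ((A (y t) - A (z t)).le_opNorm Y).trans ?_
      calc ‖A (y t) - A (z t)‖ * ‖Y‖ ≤ (K * S) * ρ := by
            gcongr
            exact (hK.norm_sub_le (hys t) (hzs t)).trans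
              (mul_le_mul_of_nonneg_left (hmax ht) K.2)
        _ = K * ρ * S := by ring
    · exact ((A (z t) - A₀).le_opNorm _).trans (by gcongr; exact hη _ (hzs t))
  have hder : ∀ t ∈ Icc (0 : ℝ) 1, HasDerivAt (fun t => y t - z t - t • A₀ (Y - Z))
      (A (y t) Y - A (z t) Z - A₀ (Y - Z)) t := fun t ht => by
    have h := ((hy t ht).sub (hz t ht)).sub ((hasDerivAt_id t).smul_const (A₀ (Y - Z)))
    rw [one_smul] at h
    exact h
  have hmv : ∀ t ∈ Icc (0 : ℝ) 1, ‖y t - z t - t • A₀ (Y - Z)‖ ≤ K * ρ * S + η * ‖Y - Z‖ := by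
    intro t ht
    have h := norm_image_sub_le_of_norm_deriv_le_segment'
      (fun t ht => (hder t ht).hasDerivWithinAt) (fun t ht => hbound t (Ico_subset_Icc_self ht)) t ht
    simp only [hyz, sub_self, zero_smul, sub_zero] at h
    refine h.trans (mul_le_of_le_one_right (by positivity) ht.2)
  have hS1 : S ≤ K * ρ * S + η * ‖Y - Z‖ + ‖A₀‖ * ‖Y - Z‖ := by
    have h1 : y t₁ - z t₁ = (y t₁ - z t₁ - t₁ • A₀ (Y - Z)) + t₁ • A₀ (Y - Z) := by abel
    rw [hS, h1]
    refine (norm_add_le _ _).trans (add_le_add (by simpa [hS] using hmv t₁ ht₁) ?_)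
    rw [norm_smul, Real.norm_of_nonneg ht₁.1]
    exact (mul_le_of_le_one_left (norm_nonneg _) ht₁.2).trans (A₀.le_opNorm _)
  -- Since `K * ρ ≤ 1 / 2`, half of `S` absorbs the term `K * ρ * S`.
  have hS2 : S ≤ 2 * (‖A₀‖ + η) * ‖Y - Z‖ := by nlinarith
  have h := hmv 1 (by simp)
  rw [one_smul] at h
  refine h.trans ?_
  have : K * ρ * S ≤ K * ρ * (2 * (‖A₀‖ + η) * ‖Y - Z‖) := by gcongr
  linarith

/-- If `A x₀` is invertible, every point near `x₀` is reached at time one by a solution of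
`z' = A(z) Y` starting at `x₀`, for a suitable constant `Y`. -/
theorem eventually_exists_hasDerivAt_clm
    {E : Type*} [NormedAddCommGroup E] [NormedSpace ℝ E] [CompleteSpace E]
    {A : E → E →L[ℝ] E} {x₀ : E} (hA : ContDiffAt ℝ 1 A x₀) (A₀ : E ≃L[ℝ] E)
    (hA₀ : A x₀ = A₀) {N : Set E} (hN : N ∈ 𝓝 x₀) :
    ∀ᶠ y in 𝓝 x₀, ∃ (Y : E) (z : ℝ → E), z 0 = x₀ ∧ z 1 = y ∧
      ∀ t ∈ Ioo (-2 : ℝ) 2, z t ∈ N ∧ HasDerivAt z (A (z t) Y) t := by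
  -- On the zero space `A₀⁻¹` has norm `0`, and `κ` below would not be positive.
  rcases subsingleton_or_nontrivial E with hE | hE
  · exact Eventually.of_forall fun y => ⟨0, fun _ => x₀, rfl, Subsingleton.elim _ _, fun t _ =>
      ⟨mem_of_mem_nhds hN, by simpa using hasDerivAt_const t x₀⟩⟩
  obtain ⟨K, s, hs, hK⟩ := hA.exists_lipschitzOnWith
  -- `κ` is the threshold of the inverse function theorem: a map approximating `A₀` up to a
  -- Lipschitz error less than `κ` is locally onto.
  set κ : ℝ := ‖(A₀.symm : E →L[ℝ] E)‖⁻¹ with hκ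
  have hκ0 : 0 < κ := inv_pos.mpr A₀.symm.norm_pos
  set η : ℝ := κ / 4 with hη
  have hη0 : 0 < η := by positivity
  have hev : ∀ᶠ x in 𝓝 x₀, ‖A x - A₀‖ ≤ η := by
    have h1 : Tendsto (fun x => ‖A x - A₀‖) (𝓝 x₀) (𝓝 ‖A x₀ - A₀‖) :=
      (hA.continuousAt.sub continuousAt_const).norm
    rw [hA₀, sub_self, norm_zero] at h1
    exact (h1.eventually (gt_mem_nhds hη0)).mono fun x hx => le_of_lt hx
  obtain ⟨R, hR, hball⟩ := Metric.nhds_basis_closedBall.mem_iff.mp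
    (inter_mem (inter_mem hs hN) hev)
  set m : ℝ := ‖(A₀ : E →L[ℝ] E)‖ + η with hm
  have hm0 : 0 < m := by positivity
  -- The three bounds serve, in order, to absorb `S` in the comparison estimate, to keep solutions
  -- of speed at most `m * ρ` in the `R`-ball up to time `2`, and to bring the total error below
  -- `κ`.
  obtain ⟨ρ, hρ0, h1, h2, h3⟩ : ∃ ρ : ℝ, 0 < ρ ∧ K * ρ ≤ 1 / 2 ∧ m * ρ * 2 ≤ R ∧
      2 * (K * ρ) * m + η < κ := by
    have hk : ∀ c d : ℝ, 0 < d → ∀ᶠ ρ : ℝ in 𝓝[>] 0, c * ρ < d := fun c d hd => by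
      have : Tendsto (fun ρ : ℝ => c * ρ) (𝓝 0) (𝓝 (c * 0)) :=
        (continuous_const.mul continuous_id).tendsto 0
      rw [mul_zero] at this
      exact (this.eventually (gt_mem_nhds hd)).filter_mono nhdsWithin_le_nhds
    obtain ⟨ρ, h0, h1, h2, h3⟩ := ((eventually_mem_nhdsWithin (s := Ioi (0 : ℝ)) (a := 0)).and
      ((hk K (1 / 2) (by norm_num)).and
      ((hk (m * 2) R hR).and (hk (2 * K * m) (κ / 2) (by positivity))))).exists
    exact ⟨ρ, h0, h1.le, by linarith, by linarith⟩
  have hsol : ∀ Y : E, ‖Y‖ ≤ ρ → ∃ z : ℝ → E, z 0 = x₀ ∧ (∀ t, z t ∈ Metric.closedBall x₀ R) ∧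
      ∀ t ∈ Ioo (-2 : ℝ) 2, HasDerivAt z (A (z t) Y) t := by
    intro Y hY
    have hpl : IsPicardLindelof (fun _ x => A x Y) (tmin := -2) (tmax := 2) ⟨0, by simp⟩ x₀
        ⟨R, hR.le⟩ 0 ⟨m * ρ, by positivity⟩ (K * ⟨ρ, hρ0.le⟩) := by
      refine IsPicardLindelof.of_time_independent (fun x hx => ?_) ?_ ?_
      · refine ((A x).le_opNorm Y).trans ?_
        change _ ≤ m * ρ
        gcongr
        have := norm_add_le (A x - A₀) (A₀ : E →L[ℝ] E)
        rw [sub_add_cancel] at this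
        have h4 : ‖A x - A₀‖ ≤ η := (hball hx).2
        linarith
      · refine LipschitzOnWith.of_dist_le_mul fun x hx y hy => ?_
        rw [dist_eq_norm, ← sub_apply]
        refine ((A x - A y).le_opNorm Y).trans ?_
        have := hK.norm_sub_le (hball hx).1.1 (hball hy).1.1
        rw [dist_eq_norm]
        calc ‖A x - A y‖ * ‖Y‖ ≤ (K * ‖x - y‖) * ρ := by gcongr
          _ = (K * ρ) * ‖x - y‖ := by ring
      · change m * ρ * max (2 - 0) (0 - -2) ≤ R - 0
        simpa using h2
    obtain ⟨z, hz0, hzb, hz⟩ := hpl.exists_forall_mem_Icc_hasDerivWithinAt_mem_closedBall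
      (x := x₀) (by simp)
    exact ⟨z, hz0, hzb, fun t ht => (hz t (Ioo_subset_Icc_self ht)).hasDerivAt
      (Icc_mem_nhds ht.1 ht.2)⟩
  choose! z hz0 hzb hz using hsol
  have hsub : Icc (0 : ℝ) 1 ⊆ Ioo (-2) 2 := fun t ht =>
    ⟨by linarith [ht.1], by linarith [ht.2]⟩
  set c : NNReal := ⟨2 * (K * ρ) * m + η, by positivity⟩ with hc
  have happ : ApproximatesLinearOn (fun Y => z Y 1) (A₀ : E →L[ℝ] E)
      (Metric.closedBall 0 ρ) c := by
    intro Y hY Z hZ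
    rw [mem_closedBall_zero_iff] at hY hZ
    exact norm_sub_sub_le_of_hasDerivAt_clm (hK.mono fun x hx => (hball hx).1.1)
      (fun x hx => (hball hx).2) h1 hY ((hz0 Y hY).trans (hz0 Z hZ).symm) (hzb Y hY) (hzb Z hZ)
      (fun t ht => hz Y hY t (hsub ht)) (fun t ht => hz Z hZ t (hsub ht))
  have hmem : Metric.closedBall (0 : E) ρ ∈ 𝓝 0 := Metric.closedBall_mem_nhds _ hρ0
  -- The Lipschitz comparison alone makes `Y ↦ z Y 1` carry neighbourhoods of `0` to neighbourhoods
  -- of its value there; no differentiability in `Y` is needed.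
  have hmap := happ.map_nhds_eq A₀.toNonlinearRightInverse hmem (Or.inr (by
    rw [← NNReal.coe_lt_coe]; exact h3))
  -- For `Y = 0` the velocity vanishes, so the solution is constant.
  have hzero : z 0 1 = x₀ := by
    have h0 : ‖(0 : E)‖ ≤ ρ := by simpa using hρ0.le
    have h := norm_image_sub_le_of_norm_deriv_le_segment' (f := z 0) (a := 0) (b := 1) (C := 0)
      (fun t ht => (hz 0 h0 t (hsub ht)).hasDerivWithinAt) (by simp) 1 (by simp)
    rw [hz0 0 h0] at h
    simpa [sub_eq_zero] using h
  simp only [hzero] at hmap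
  rw [← hmap]
  filter_upwards [image_mem_map hmem] with y hy
  obtain ⟨Y, hY, rfl⟩ := hy
  rw [mem_closedBall_zero_iff] at hY
  exact ⟨Y, z Y, hz0 Y hY, rfl, fun t ht => ⟨(hball (hzb Y hY t)).1.2, hz Y hY t ht⟩⟩

/-! ### Smooth parallelisms and the fields on which they are constant. -/

section Parallelism

variable {E : Type*} [NormedAddCommGroup E] [NormedSpace ℝ E]
  {B : Type*} [TopologicalSpace B] [ChartedSpace E B] [IsManifold 𝓘(ℝ, E) ∞ B]

/-- A vector-valued one-form near `x₀`, read in the trivialization of the tangent bundle at `x₀`. -/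
noncomputable def formInTrivialization (θ : ∀ x : B, TangentSpace 𝓘(ℝ, E) x →L[ℝ] E)
    (x₀ b : B) : E →L[ℝ] E :=
  haveI : IsManifold 𝓘(ℝ, E) 1 B := .of_le (n := ∞) (by simp)
  (θ b).comp ((trivializationAt E (TangentSpace 𝓘(ℝ, E) : B → Type _) x₀).symmL ℝ b)

lemma contDiffOn_formInTrivialization [FiniteDimensional ℝ E]
    {θ : ∀ x : B, TangentSpace 𝓘(ℝ, E) x →L[ℝ] E}
    (hθ : ContMDiff (M' := E) 𝓘(ℝ, E).tangent 𝓘(ℝ, E) ∞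
      fun v : TangentBundle 𝓘(ℝ, E) B => θ v.1 v.2) (x₀ : B) :
    ContDiffOn ℝ ∞ (fun z => formInTrivialization θ x₀ ((chartAt E x₀).symm z))
      (chartAt E x₀).target := by
  have : IsManifold 𝓘(ℝ, E) 1 B := .of_le (n := ∞) (by simp)
  set T := trivializationAt E (TangentSpace 𝓘(ℝ, E) : B → Type _) x₀ with hT
  -- In finite dimension an operator-valued map is smooth once its values on each fixed `v` are;
  -- these are `θ` composed with a smooth local section of the tangent bundle.
  rw [contDiffOn_clm_apply]
  intro v
  rw [← contMDiffOn_iff_contDiffOn]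
  have h1 : ContMDiffOn 𝓘(ℝ, E) (𝓘(ℝ, E).prod 𝓘(ℝ, E)) ∞
      (fun z => ((chartAt E x₀).symm z, v)) (chartAt E x₀).target :=
    contMDiffOn_chart_symm.prodMk contMDiffOn_const
  have hmaps : ∀ z ∈ (chartAt E x₀).target, (chartAt E x₀).symm z ∈ T.baseSet :=
    fun z hz => (chartAt E x₀).map_target hz
  have h2 : ContMDiffOn 𝓘(ℝ, E) 𝓘(ℝ, E).tangent ∞
      (fun z => T.toOpenPartialHomeomorph.symm ((chartAt E x₀).symm z, v))
      (chartAt E x₀).target :=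
    T.contMDiffOn_symm.comp h1 fun z hz => T.mem_target.mpr (hmaps z hz)
  refine (hθ.comp_contMDiffOn h2).congr fun z hz => ?_
  simp only [Function.comp_apply]
  rw [← T.mk_symm (hmaps z hz)]
  exact congrArg (θ ((chartAt E x₀).symm z)) (T.symmL_apply (R := ℝ) (hmaps z hz) v)

lemma formInTrivialization_apply_snd (θ : ∀ x : B, TangentSpace 𝓘(ℝ, E) x →L[ℝ] E) {x₀ b : B}
    (hb : b ∈ (chartAt E x₀).source) (v : TangentSpace 𝓘(ℝ, E) b) :
    formInTrivialization θ x₀ b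
      (trivializationAt E (TangentSpace 𝓘(ℝ, E) : B → Type _) x₀ ⟨b, v⟩).2 = θ b v := by
  have : IsManifold 𝓘(ℝ, E) 1 B := .of_le (n := ∞) (by simp)
  set T := trivializationAt E (TangentSpace 𝓘(ℝ, E) : B → Type _) x₀ with hT
  have hb' : b ∈ T.baseSet := hb
  refine congrArg (θ b) ?_
  rw [← T.continuousLinearMapAt_apply_of_mem ℝ hb']
  exact T.symmL_continuousLinearMapAt hb' v

lemma bijective_formInTrivialization {θ : ∀ x : B, TangentSpace 𝓘(ℝ, E) x →L[ℝ] E}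
    {x₀ b : B} (hb : b ∈ (chartAt E x₀).source) (hθ : Function.Bijective (θ b)) :
    Function.Bijective (formInTrivialization θ x₀ b) := by
  have : IsManifold 𝓘(ℝ, E) 1 B := .of_le (n := ∞) (by simp)
  set T := trivializationAt E (TangentSpace 𝓘(ℝ, E) : B → Type _) x₀ with hT
  have hb' : b ∈ T.baseSet := hb
  have h := (T.continuousLinearEquivAt ℝ b hb').symm.bijective
  rw [T.symm_continuousLinearEquivAt_eq (R := ℝ) hb'] at h
  exact hθ.comp h

lemma exists_formInTrivialization_eq_equiv [FiniteDimensional ℝ E]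
    {θ : ∀ x : B, TangentSpace 𝓘(ℝ, E) x →L[ℝ] E}
    {x₀ b : B} (hb : b ∈ (chartAt E x₀).source) (hθ : Function.Bijective (θ b)) :
    ∃ L : E ≃L[ℝ] E, formInTrivialization θ x₀ b = L :=
  have h := bijective_formInTrivialization hb hθ
  ⟨(LinearEquiv.ofBijective (formInTrivialization θ x₀ b : E →ₗ[ℝ] E) h).toContinuousLinearEquiv,
    rfl⟩

lemma contDiffOn_inverse_formInTrivialization [FiniteDimensional ℝ E]
    {θ : ∀ x : B, TangentSpace 𝓘(ℝ, E) x →L[ℝ] E}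
    (hθ : ContMDiff (M' := E) 𝓘(ℝ, E).tangent 𝓘(ℝ, E) ∞
      fun v : TangentBundle 𝓘(ℝ, E) B => θ v.1 v.2)
    (hbij : ∀ x, Function.Bijective (θ x)) (x₀ : B) :
    ContDiffOn ℝ ∞ (fun z => (formInTrivialization θ x₀ ((chartAt E x₀).symm z)).inverse)
      (chartAt E x₀).target := by
  have : CompleteSpace E := FiniteDimensional.complete ℝ E
  intro z hz
  obtain ⟨L, hL⟩ := exists_formInTrivialization_eq_equiv ((chartAt E x₀).map_target hz)
    (hbij ((chartAt E x₀).symm z))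
  have h := contDiffAt_map_inverse (n := ∞) (𝕜 := ℝ) L
  rw [← hL] at h
  exact h.comp_contDiffWithinAt z (contDiffOn_formInTrivialization hθ x₀ z hz)

/-- This turns the condition `θ (V) = Y` into the equation `z' = A(z) Y` in a chart, where `A` is
the pointwise inverse of the form read in the trivialization. -/
lemma trivialization_snd_eq_inverse [FiniteDimensional ℝ E]
    {θ : ∀ x : B, TangentSpace 𝓘(ℝ, E) x →L[ℝ] E}
    {x₀ b : B} (hb : b ∈ (chartAt E x₀).source) (hθ : Function.Bijective (θ b))
    (v : TangentSpace 𝓘(ℝ, E) b) :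
    (trivializationAt E (TangentSpace 𝓘(ℝ, E) : B → Type _) x₀ ⟨b, v⟩).2 =
      (formInTrivialization θ x₀ b).inverse (θ b v) := by
  obtain ⟨L, hL⟩ := exists_formInTrivialization_eq_equiv hb hθ
  rw [← formInTrivialization_apply_snd θ hb v, hL, ContinuousLinearMap.inverse_equiv]
  exact (L.symm_apply_apply _).symm

/-- A vector field on which a smooth parallelism is constant is smooth. -/
theorem contMDiff_of_form_apply_eq_const [FiniteDimensional ℝ E]
    {θ : ∀ x : B, TangentSpace 𝓘(ℝ, E) x →L[ℝ] E}
    (hθ : ContMDiff (M' := E) 𝓘(ℝ, E).tangent 𝓘(ℝ, E) ∞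
      fun v : TangentBundle 𝓘(ℝ, E) B => θ v.1 v.2)
    (hbij : ∀ x, Function.Bijective (θ x)) {Y : E} {V : ∀ x : B, TangentSpace 𝓘(ℝ, E) x}
    (hV : ∀ x, θ x (V x) = Y) :
    ContMDiff 𝓘(ℝ, E) 𝓘(ℝ, E).tangent ∞
      (fun x => (⟨x, V x⟩ : TangentBundle 𝓘(ℝ, E) B)) := by
  intro x₀
  have : IsManifold 𝓘(ℝ, E) 1 B := .of_le (n := ∞) (by simp)
  rw [Bundle.contMDiffAt_section]
  have h1 : ContDiffOn ℝ ∞ (fun z =>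
      (formInTrivialization θ x₀ ((chartAt E x₀).symm z)).inverse Y) (chartAt E x₀).target :=
    (contDiffOn_inverse_formInTrivialization hθ hbij x₀).clm_apply contDiffOn_const
  have h2 := h1.contMDiffOn.comp (contMDiffOn_chart (I := 𝓘(ℝ, E)) (x := x₀) (n := ∞))
    fun b hb => (chartAt E x₀).map_source hb
  have hnhds : (chartAt E x₀).source ∈ 𝓝 x₀ := chart_source_mem_nhds E x₀
  refine (h2.contMDiffAt hnhds).congr_of_eventuallyEq ?_
  filter_upwards [hnhds] with b hb
  rw [trivialization_snd_eq_inverse hb (hbij b), hV]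
  simp [(chartAt E x₀).left_inv hb]

/-- Every point near `x₀` is joined to `x₀` by an integral curve of a vector field on which the
given smooth parallelism is constant. -/
theorem eventually_exists_isMIntegralCurveOn [FiniteDimensional ℝ E]
    {θ : ∀ x : B, TangentSpace 𝓘(ℝ, E) x →L[ℝ] E}
    (hθ : ContMDiff (M' := E) 𝓘(ℝ, E).tangent 𝓘(ℝ, E) ∞
      fun v : TangentBundle 𝓘(ℝ, E) B => θ v.1 v.2)
    (hbij : ∀ x, Function.Bijective (θ x)) (x₀ : B) :
    ∀ᶠ y in 𝓝 x₀, ∃ V : ∀ x : B, TangentSpace 𝓘(ℝ, E) x, (∃ Y : E, ∀ x, θ x (V x) = Y) ∧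
      ∃ γ : ℝ → B, γ 0 = x₀ ∧ γ 1 = y ∧ IsMIntegralCurveOn γ V (Ioo (-2) 2) := by
  have : CompleteSpace E := FiniteDimensional.complete ℝ E
  have : IsManifold 𝓘(ℝ, E) 1 B := .of_le (n := ∞) (by simp)
  set φ := chartAt E x₀ with hφ
  set T := trivializationAt E (TangentSpace 𝓘(ℝ, E) : B → Type _) x₀ with hT
  have hx₀ : x₀ ∈ φ.source := mem_chart_source E x₀
  have htgt : φ.target ∈ 𝓝 (φ x₀) := φ.open_target.mem_nhds (φ.map_source hx₀)
  obtain ⟨L, hL⟩ := exists_formInTrivialization_eq_equiv hx₀ (hbij x₀)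
  have hA : ContDiffAt ℝ 1
      (fun z => (formInTrivialization θ x₀ (φ.symm z)).inverse) (φ x₀) :=
    ((contDiffOn_inverse_formInTrivialization hθ hbij x₀).contDiffAt htgt).of_le (by simp)
  have hev := eventually_exists_hasDerivAt_clm hA L.symm
    (by rw [φ.left_inv hx₀, hL, ContinuousLinearMap.inverse_equiv]) htgt
  filter_upwards [(φ.continuousAt hx₀).eventually hev, φ.open_source.mem_nhds hx₀] with y hy hys
  obtain ⟨Y, z, hz0, hz1, hz⟩ := hy
  -- The chart solution only has a direction `Y ∈ E`; the parallelism extends it to a global field.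
  choose V hV using fun x => (hbij x).surjective Y
  refine ⟨V, ⟨Y, hV⟩, fun t => φ.symm (z t), by simp only [hz0, φ.left_inv hx₀],
    by simp only [hz1, φ.left_inv hys], fun t ht => ?_⟩
  obtain ⟨ht1, ht2⟩ := hz t ht
  have hs : φ.symm (z t) ∈ φ.source := φ.map_target ht1
  -- The derivative of the inverse chart is the inverse of the tangent trivialization, so the lifted
  -- curve has velocity `T.symmL` applied to `A(z) Y`.
  have hφs : HasMFDerivAt 𝓘(ℝ, E) 𝓘(ℝ, E) φ.symm (z t) (T.symmL ℝ (φ.symm (z t))) := by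
    have h := TangentBundle.symmL_trivializationAt (I := 𝓘(ℝ, E)) hs
    have hd : MDifferentiableAt 𝓘(ℝ, E) 𝓘(ℝ, E) φ.symm (z t) :=
      (mdifferentiableOn_atlas_symm (chart_mem_atlas E x₀)).mdifferentiableAt
        (φ.open_target.mem_nhds ht1)
    rw [h]
    have h3 := hd.hasMFDerivAt
    simp only [modelWithCornersSelf_coe, range_id, mfderivWithin_univ, extChartAt, mfld_simps]
    rw [φ.right_inv ht1]
    exact h3
  have hcomp := hφs.comp t ht2.hasFDerivAt.hasMFDerivAt
  refine HasMFDerivAt.hasMFDerivWithinAt ?_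
  refine hcomp.congr_mfderiv ?_
  have key : T.symmL ℝ (φ.symm (z t)) ((formInTrivialization θ x₀ (φ.symm (z t))).inverse Y) =
      V (φ.symm (z t)) := by
    rw [← hV (φ.symm (z t)), ← trivialization_snd_eq_inverse hs (hbij _),
      ← T.continuousLinearMapAt_apply_of_mem ℝ hs]
    exact T.symmL_continuousLinearMapAt hs _
  refine ContinuousLinearMap.ext fun s : ℝ => ?_
  refine Eq.trans ?_ (congrArg (fun w : E => s • w) key)
  exact (T.symmL ℝ (φ.symm (z t))).map_smul s _

end Parallelism

/-- By the chain rule. It serves for left translations of `G` and for the map `G → B`. -/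
lemma IsMIntegralCurveOn.map
    {E E' : Type*} [NormedAddCommGroup E] [NormedSpace ℝ E]
    [NormedAddCommGroup E'] [NormedSpace ℝ E']
    {B : Type*} [TopologicalSpace B] [ChartedSpace E B]
    {B' : Type*} [TopologicalSpace B'] [ChartedSpace E' B'] {f : B → B'}
    {V : ∀ x : B, TangentSpace 𝓘(ℝ, E) x} {V' : ∀ x : B', TangentSpace 𝓘(ℝ, E') x}
    (hf : MDifferentiable 𝓘(ℝ, E) 𝓘(ℝ, E') f)
    (hV : ∀ x, mfderiv 𝓘(ℝ, E) 𝓘(ℝ, E') f x (V x) = V' (f x))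
    {γ : ℝ → B} {s : Set ℝ} (hγ : IsMIntegralCurveOn γ V s) :
    IsMIntegralCurveOn (f ∘ γ) V' s := fun t ht => by
  refine ((hf (γ t)).hasMFDerivAt.comp_hasMFDerivWithinAt t (hγ t ht)).congr_mfderiv ?_
  refine ContinuousLinearMap.ext fun s : ℝ => ?_
  refine Eq.trans ?_ (congrArg (fun w : E' => s • w) (hV (γ t)))
  exact (mfderiv 𝓘(ℝ, E) 𝓘(ℝ, E') f (γ t)).map_smul s _

/-! ### Completeness on the group and propagation of the range. -/

section LieGroup

variable {E : Type*} [NormedAddCommGroup E] [NormedSpace ℝ E]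
  {G : Type*} [TopologicalSpace G] [ChartedSpace E G] [Group G] [LieGroup 𝓘(ℝ, E) ∞ G]

lemma bijective_maurerCartan (g : G) : Function.Bijective (maurerCartan E g) :=
  (Diffeomorph.smul 𝓘(ℝ, E) 𝓘(ℝ, E) ∞ g⁻¹ :
    G ≃ₘ^∞⟮𝓘(ℝ, E), 𝓘(ℝ, E)⟯ G).mfderivToContinuousLinearEquiv (by simp) g |>.bijective

/-- Left-invariant vector fields on a Lie group are complete. -/
theorem exists_isMIntegralCurve_of_maurerCartan_eq_const [FiniteDimensional ℝ E] [T2Space G]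
    {Y : E} {V : ∀ g : G, TangentSpace 𝓘(ℝ, E) g} (hV : ∀ g, maurerCartan E g (V g) = Y) (g : G) :
    ∃ γ : ℝ → G, γ 0 = g ∧ IsMIntegralCurve γ V := by
  have : CompleteSpace E := FiniteDimensional.complete ℝ E
  have : IsManifold 𝓘(ℝ, E) ∞ G := ContMDiffMul.toIsManifold
  have : IsManifold 𝓘(ℝ, E) 1 G := .of_le (n := ∞) (by simp)
  have hsmooth : ContMDiff 𝓘(ℝ, E) 𝓘(ℝ, E).tangent 1
      (fun x => (⟨x, V x⟩ : TangentBundle 𝓘(ℝ, E) G)) :=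
    (contMDiff_of_form_apply_eq_const (θ := maurerCartan E) KleinBundle.contMDiff_maurerCartan
      bijective_maurerCartan hV).of_le (by simp)
  obtain ⟨γ, hγ0, hγ⟩ := exists_isMIntegralCurveAt_of_contMDiffAt_boundaryless (t₀ := 0)
    (hsmooth.contMDiffAt (x := 1))
  obtain ⟨ε, hε, hγ⟩ := isMIntegralCurveAt_iff'.mp hγ
  rw [Real.ball_eq_Ioo, zero_sub, zero_add] at hγ
  -- Left translates of one curve through `1` exist on the same interval of radius `ε` at every
  -- point, and a uniform existence time implies completeness.
  refine exists_isMIntegralCurve_of_isMIntegralCurveOn hsmooth hε (fun h => ?_) g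
  refine ⟨fun t => h * γ t, by simp [hγ0], ?_⟩
  refine IsMIntegralCurveOn.map (f := fun z => h * z) (KleinBundle.mdiff_left h) (fun x => ?_) hγ
  apply (bijective_maurerCartan (h * x)).injective
  rw [KleinBundle.maurerCartan_mul_left, hV, hV]

/-- The range of a map from a Lie group to a parallelized manifold which pulls back the
parallelism to the Maurer-Cartan form is open and closed. -/
theorem isClopen_range_of_pullback_eq_maurerCartan [FiniteDimensional ℝ E] [T2Space G]
    {B : Type*} [TopologicalSpace B] [ChartedSpace E B] [IsManifold 𝓘(ℝ, E) ∞ B] [T2Space B]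
    {θ : ∀ x : B, TangentSpace 𝓘(ℝ, E) x →L[ℝ] E}
    (hθ : ContMDiff (M' := E) 𝓘(ℝ, E).tangent 𝓘(ℝ, E) ∞
      fun v : TangentBundle 𝓘(ℝ, E) B => θ v.1 v.2)
    (hbij : ∀ x, Function.Bijective (θ x)) {f : G → B}
    (hf : MDifferentiable 𝓘(ℝ, E) 𝓘(ℝ, E) f)
    (hpull : ∀ (g : G) (v : TangentSpace 𝓘(ℝ, E) g),
      θ (f g) (mfderiv 𝓘(ℝ, E) 𝓘(ℝ, E) f g v) = maurerCartan E g v) :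
    IsClopen (range f) := by
  have : CompleteSpace E := FiniteDimensional.complete ℝ E
  have : IsManifold 𝓘(ℝ, E) 1 B := .of_le (n := ∞) (by simp)
  -- Membership in the range is locally constant, which gives openness of both the range and its
  -- complement.
  have key : ∀ x, ∀ᶠ y in 𝓝 x, (x ∈ range f ↔ y ∈ range f) := by
    intro x
    filter_upwards [eventually_exists_isMIntegralCurveOn hθ hbij x] with y hy
    obtain ⟨V', ⟨Y, hV'⟩, γ, hγ0, hγ1, hγ⟩ := hy
    choose V hV using fun g : G => (bijective_maurerCartan (E := E) g).surjective Y
    have hVV' : ∀ g, mfderiv 𝓘(ℝ, E) 𝓘(ℝ, E) f g (V g) = V' (f g) := fun g =>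
      (hbij (f g)).injective (by rw [hpull, hV, hV'])
    have hreach : ∀ t₀ ∈ Ioo (-2 : ℝ) 2, γ t₀ ∈ range f →
        ∀ t ∈ Ioo (-2 : ℝ) 2, γ t ∈ range f := by
      rintro t₀ ht₀ ⟨g, hg⟩ t ht
      obtain ⟨c, hc0, hc⟩ := exists_isMIntegralCurve_of_maurerCartan_eq_const hV g
      -- The time shift makes the curve pass through `g` at `t₀`. Completeness of `c` is essential:
      -- its image covers the whole lifetime of `γ`.
      have hc' := (hc.comp_add (-t₀)).isMIntegralCurveOn (Ioo (-2) 2)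
      have heq := isMIntegralCurveOn_Ioo_eqOn_of_contMDiff_boundaryless ht₀
        ((contMDiff_of_form_apply_eq_const hθ hbij hV').of_le (by simp)) hγ
        (hc'.map hf hVV') (by simp [hc0, hg])
      exact ⟨_, (heq ht).symm⟩
    rw [← hγ0, ← hγ1]
    exact ⟨fun h => hreach 0 (by simp) h 1 (by norm_num),
      fun h => hreach 1 (by norm_num) h 0 (by simp)⟩
  refine ⟨isOpen_compl_iff.mp (isOpen_iff_mem_nhds.mpr fun x hx => ?_),
    isOpen_iff_mem_nhds.mpr fun x hx => ?_⟩
  · filter_upwards [key x] with y hy using fun h => hx (hy.mpr h)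
  · filter_upwards [key x] with y hy using hy.mp hx

end LieGroup

/-! ### Descent to the connected base and maximality. -/

/-- A map from a Lie group into the total space of a Cartan geometry with the same model, over a
connected base, is onto if it is equivariant and pulls back the connection to the Maurer-Cartan
form. -/
theorem CartanGeometry.surjective_of_pullback_eq_maurerCartan
    {E : Type*} [NormedAddCommGroup E] [NormedSpace ℝ E] [FiniteDimensional ℝ E]
    {G : Type*} [TopologicalSpace G] [ChartedSpace E G] [Group G] [LieGroup 𝓘(ℝ, E) ∞ G]
    [T2Space G] {P : Subgroup G}
    {N : Type*} [TopologicalSpace N] [ConnectedSpace N]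
    {B : Type*} [TopologicalSpace B] [ChartedSpace E B] (C : CartanGeometry E P N B)
    {f : G → B} (hf : MDifferentiable 𝓘(ℝ, E) 𝓘(ℝ, E) f)
    (hequiv : ∀ (g : G) (p : P), f (g * p) = C.act (f g) p)
    (hpull : ∀ (g : G) (v : TangentSpace 𝓘(ℝ, E) g),
      C.form (f g) (mfderiv 𝓘(ℝ, E) 𝓘(ℝ, E) f g v) = maurerCartan E g v) :
    Function.Surjective f := by
  have := C.isManifold
  have := C.t2Space
  have hclopen : IsClopen (range f) :=
    isClopen_range_of_pullback_eq_maurerCartan C.form_smooth C.form_bijective hf hpull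
  -- The fibres of `C.proj` are `P`-orbits and equivariance makes the range a union of them, so
  -- clopenness passes to the quotient and surjectivity lifts back.
  have hsat : C.proj ⁻¹' (C.proj '' range f) = range f := by
    refine Subset.antisymm ?_ (subset_preimage_image _ _)
    rintro y ⟨_, ⟨g, rfl⟩, hy⟩
    obtain ⟨p, rfl⟩ := (C.proj_eq_iff _ _).mp hy
    exact ⟨g * p, hequiv g p⟩
  have himage : IsClopen (C.proj '' range f) := by
    rw [← C.isQuotientMap_proj.isClopen_preimage, hsat]
    exact hclopen
  have huniv := himage.eq_univ ((range_nonempty f).image _)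
  rw [← range_eq_univ, ← hsat, huniv, preimage_univ]

theorem mainTheorem12 {E : Type*} [NormedAddCommGroup E] [NormedSpace ℝ E]
    [FiniteDimensional ℝ E] {G : Type*} [TopologicalSpace G] [ChartedSpace E G] [Group G]
    [LieGroup 𝓘(ℝ, E) ∞ G] [T2Space G] [SecondCountableTopology G]
    (P : Subgroup G) (hP : IsClosed (P : Set G)) [FaithfulSMul P (G ⧸ P)]
    (Γ : Subgroup G) [DiscreteTopology Γ]
    (hfree : ∀ (γ : Γ) (y : G ⧸ P), γ • y = y → γ = 1) [ProperSMul Γ (G ⧸ P)] :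
    CartanGeometry.IsMaximal.{uN, uB} (kleinianGeometry E P hP Γ hfree) := by
  intro N _ _ B' _ _ C' σ hσ
  have hsmooth : MDifferentiable 𝓘(ℝ, E) 𝓘(ℝ, E) σ :=
    hσ.isSmoothEmbedding.contMDiff.mdifferentiable (by simp)
  -- If the composite from `G` is onto, so is its last factor `σ`.
  refine (C'.surjective_of_pullback_eq_maurerCartan (f := σ ∘ KleinBundle.mk Γ)
    (fun g => (hsmooth _).comp g (KleinBundle.mdiff_mk Γ g))
    (fun g p => hσ.equivariant (KleinBundle.mk Γ g) p) fun g v => ?_).of_comp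
  have h := mfderiv_comp_apply g (hsmooth (KleinBundle.mk Γ g)) (KleinBundle.mdiff_mk Γ g) v
  refine (congrArg (C'.form (σ (KleinBundle.mk Γ g))) h).trans ?_
  exact (hσ.pullback _ _).trans (KleinBundle.form_mk Γ g v)
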